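/- Let $K$ be a field and let $G$ be a finite simple graph with at least one edge. Let $n$ be the number of vertices of $G$ and let $d \geq 1$ be the maximum degree of a vertex of $G$. Let $S = K[V(G)]$ be the polynomial ring over $K$ whose variables are the vertices of $G$, and let $I(G) \subseteq S$ be the edge ideal of $G$, that is, the ideal generated by the products $xy$ over all edges $\{x,y\}$ of $G$. Then the projective dimension of the $S$-module $S/I(G)$ is a nonnegative integer and satisfies $$\operatorname{pd}(S/I(G)) \leq n\left(1-\frac{1}{2d}\right).$$ -/

import Mathlib

/-- The edge ideal of a simple graph `G` over `K`: the ideal of the polynomial ring over `K` on the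
vertices of `G` that is generated by the products `x * y` over all edges `{x, y}` of `G`. -/
noncomputable def SimpleGraph.edgeIdeal {V : Type*} (G : SimpleGraph V) (K : Type*) [Field K] :
    Ideal (MvPolynomial V K) :=
  Ideal.span {f | ∃ x y : V, G.Adj x y ∧ f = MvPolynomial.X x * MvPolynomial.X y}

open CategoryTheory MvPolynomial

/-! For disjoint `A`, `B` let `I` be the edge ideal of `G[A]` plus the variables in `B`. For a
variable `y` in `A`, `pd (S/I)` is at most the larger of the values for `I : y` and `I + (y)`. Both
have the same shape: the colon turns the neighbours of `y` into variables and frees `y`, the sum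
moves `y` from `A` to `B`.

Induction on `|A|` bounds `pd` by the floor of `|A| + |B| - (|A| + s)/(2d)`. Here `s` counts
neighbours of a fixed `x` already moved to `B`; it offsets the loss in `|A|` along the sum branch.
Once `x` is isolated, it is discarded and `s` returns to 0. The theorem is the case `A = V`, `B =
∅`, `s = 0`. -/

/-- The sequence `0 → R / (I : a) → R / I → R / (I + (a)) → 0` is exact. -/
theorem Ideal.exists_shortExact_colon {R : Type*} [CommRing R] {I J L : Ideal R} {a : R}
    (hJ : ∀ f, f * a ∈ I ↔ f ∈ J) (hL : L = I ⊔ Ideal.span {a}) :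
    ∃ S : ShortComplex (ModuleCat R), S.ShortExact ∧ S.X₁ = ModuleCat.of R (R ⧸ J) ∧
      S.X₂ = ModuleCat.of R (R ⧸ I) ∧ S.X₃ = ModuleCat.of R (R ⧸ L) := by
  have hIL : I ≤ L := hL ▸ le_sup_left
  let f : (R ⧸ J) →ₗ[R] (R ⧸ I) :=
    Submodule.mapQ J I (LinearMap.mulRight R a) fun x hx => (hJ x).2 hx
  let g : (R ⧸ I) →ₗ[R] (R ⧸ L) := Submodule.factor hIL
  have hf : Function.Injective f := by
    rw [injective_iff_map_eq_zero]
    intro x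
    obtain ⟨x, rfl⟩ := Submodule.Quotient.mk_surjective J x
    intro hx
    rw [Submodule.Quotient.mk_eq_zero]
    exact (hJ x).1 ((Submodule.Quotient.mk_eq_zero I).1 hx)
  have hg : Function.Surjective g := Submodule.factor_surjective hIL
  have hfg : Function.Exact f g := by
    intro y
    obtain ⟨y, rfl⟩ := Submodule.Quotient.mk_surjective I y
    constructor
    · intro hy
      have hy : y ∈ L := (Submodule.Quotient.mk_eq_zero L).1 hy
      rw [hL, Submodule.mem_sup] at hy
      obtain ⟨i, hi, z, hz, rfl⟩ := hy
      obtain ⟨b, rfl⟩ := Ideal.mem_span_singleton'.1 hz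
      refine ⟨Submodule.Quotient.mk b, (Submodule.Quotient.eq I).2 ?_⟩
      simpa using hi
    · rintro ⟨x, hx⟩
      obtain ⟨x, rfl⟩ := Submodule.Quotient.mk_surjective J x
      rw [← hx]
      refine (Submodule.Quotient.mk_eq_zero L).2 ?_
      rw [hL]
      exact Ideal.mem_sup_right (Ideal.mul_mem_left _ x (Ideal.mem_span_singleton_self a))
  exact ⟨_, ModuleCat.shortComplex_shortExact (ShortComplex.mk (ModuleCat.ofHom f)
    (ModuleCat.ofHom g) (ModuleCat.hom_ext (LinearMap.ext hfg.apply_apply_eq_zero))) hfg hf hg, rfl, rfl, rfl⟩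

theorem Ideal.hasProjectiveDimensionLE_quotient_of_colon {R : Type*} [CommRing R]
    {I J L : Ideal R} {a : R} (hJ : ∀ f, f * a ∈ I ↔ f ∈ J) (hL : L = I ⊔ Ideal.span {a}) (n : ℕ)
    (h₁ : HasProjectiveDimensionLE (ModuleCat.of R (R ⧸ J)) n)
    (h₂ : HasProjectiveDimensionLE (ModuleCat.of R (R ⧸ L)) n) :
    HasProjectiveDimensionLE (ModuleCat.of R (R ⧸ I)) n := by
  obtain ⟨S, hS, e₁, e₂, e₃⟩ := Ideal.exists_shortExact_colon hJ hL
  rw [← e₂]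
  exact hS.hasProjectiveDimensionLT_X₂ _ (e₁ ▸ h₁) (e₃ ▸ h₂)

/-- Here `a` is a nonzerodivisor on `R / I`, so the first two terms of the exact sequence coincide.
-/
theorem Ideal.hasProjectiveDimensionLE_quotient_sup_span_singleton {R : Type*} [CommRing R]
    {I L : Ideal R} {a : R} (ha : ∀ f, f * a ∈ I ↔ f ∈ I) (hL : L = I ⊔ Ideal.span {a}) (n : ℕ)
    (h : HasProjectiveDimensionLE (ModuleCat.of R (R ⧸ I)) n) :
    HasProjectiveDimensionLE (ModuleCat.of R (R ⧸ L)) (n + 1) := by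
  obtain ⟨S, hS, e₁, e₂, e₃⟩ := Ideal.exists_shortExact_colon ha hL
  rw [← e₃]
  exact hS.hasProjectiveDimensionLT_X₃ _ (e₁ ▸ h) (e₂ ▸ hasProjectiveDimensionLT_of_ge _ (n + 1) _
    (Nat.le_succ _))

namespace SimpleGraph

variable {V : Type*} (G : SimpleGraph V) (K : Type*) [Field K]

/-- The exponents of the products `x * y` over the edges of `G` inside `A` and of the variables
in `B`. -/
def edgeVarExponents (A B : Finset V) : Set (V →₀ ℕ) :=
  {m | (∃ x ∈ A, ∃ y ∈ A, G.Adj x y ∧ m = Finsupp.single x 1 + Finsupp.single y 1) ∨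
    ∃ x ∈ B, m = Finsupp.single x 1}

/-- The edge ideal of the subgraph of `G` induced on `A`, plus the ideal generated by the variables
in `B`. -/
noncomputable def edgeVarIdeal (A B : Finset V) : Ideal (MvPolynomial V K) :=
  Ideal.span ((fun m => monomial m (1 : K)) '' G.edgeVarExponents A B)

theorem single_one_le_iff {x : V} {m : V →₀ ℕ} : Finsupp.single x 1 ≤ m ↔ m x ≠ 0 := by
  rw [Finsupp.single_le_iff, Nat.one_le_iff_ne_zero]

theorem exists_mem_edgeVarExponents_le_iff {A B : Finset V} {m : V →₀ ℕ} :
    (∃ s ∈ G.edgeVarExponents A B, s ≤ m) ↔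
      (∃ x ∈ A, ∃ y ∈ A, G.Adj x y ∧ m x ≠ 0 ∧ m y ≠ 0) ∨ ∃ x ∈ B, m x ≠ 0 := by
  classical
  constructor
  · rintro ⟨s, ⟨x, hx, y, hy, hxy, rfl⟩ | ⟨x, hx, rfl⟩, hs⟩
    · exact .inl ⟨x, hx, y, hy, hxy, single_one_le_iff.1 (le_self_add.trans hs),
        single_one_le_iff.1 (le_add_self.trans hs)⟩
    · exact .inr ⟨x, hx, single_one_le_iff.1 hs⟩
  · rintro (⟨x, hx, y, hy, hxy, hmx, hmy⟩ | ⟨x, hx, hm⟩)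
    · refine ⟨_, .inl ⟨x, hx, y, hy, hxy, rfl⟩, fun z => ?_⟩
      have := hxy.ne
      simp only [Finsupp.add_apply, Finsupp.single_apply]
      split_ifs <;> subst_vars <;> first | omega | contradiction
    · exact ⟨_, .inr ⟨x, hx, rfl⟩, single_one_le_iff.2 hm⟩

/-- A monomial ideal is tested one exponent at a time, so the colon and sum identities below become
case checks on vertices. -/
theorem mem_edgeVarIdeal_iff {A B : Finset V} {f : MvPolynomial V K} :
    f ∈ G.edgeVarIdeal K A B ↔ ∀ m ∈ f.support,
      (∃ x ∈ A, ∃ y ∈ A, G.Adj x y ∧ m x ≠ 0 ∧ m y ≠ 0) ∨ ∃ x ∈ B, m x ≠ 0 := by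
  simp only [edgeVarIdeal, mem_ideal_span_monomial_image, exists_mem_edgeVarExponents_le_iff]

theorem edgeIdeal_eq_edgeVarIdeal [Fintype V] :
    G.edgeIdeal K = G.edgeVarIdeal K Finset.univ ∅ := by
  unfold edgeIdeal edgeVarIdeal
  congr 1
  ext f
  constructor
  · rintro ⟨x, y, hxy, rfl⟩
    exact ⟨_, .inl ⟨x, Finset.mem_univ _, y, Finset.mem_univ _, hxy, rfl⟩,
      by simp [X, monomial_mul]⟩
  · rintro ⟨_, ⟨x, -, y, -, hxy, rfl⟩ | ⟨x, hx, -⟩, rfl⟩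
    · exact ⟨x, y, hxy, by simp [X, monomial_mul]⟩
    · simp at hx

theorem edgeVarIdeal_ne_top (A B : Finset V) : G.edgeVarIdeal K A B ≠ ⊤ := by
  rw [Ne, Ideal.eq_top_iff_one, mem_edgeVarIdeal_iff]
  intro h
  simpa using h 0 (by simp)

theorem edgeVarIdeal_sup_span_X [DecidableEq V] {A B : Finset V} (y : V) :
    G.edgeVarIdeal K (A.erase y) (insert y B) =
      G.edgeVarIdeal K A B ⊔ Ideal.span {(X y : MvPolynomial V K)} := by
  have : G.edgeVarIdeal K A B ⊔ Ideal.span {(X y : MvPolynomial V K)} =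
      Ideal.span ((fun m => monomial m (1 : K)) ''
        (G.edgeVarExponents A B ∪ {Finsupp.single y 1})) := by
    rw [Set.image_union, Ideal.span_union, Set.image_singleton]
    rfl
  ext f
  rw [this, mem_ideal_span_monomial_image, mem_edgeVarIdeal_iff]
  refine forall₂_congr fun m _ => ?_
  simp only [Set.mem_union, Set.mem_singleton_iff, or_and_right, exists_or, exists_eq_left,
    exists_mem_edgeVarExponents_le_iff, single_one_le_iff, Finset.mem_erase, Finset.mem_insert]
  grind

theorem mul_X_mem_edgeVarIdeal_iff_of_notMem {A B : Finset V} {y : V} (hA : y ∉ A) (hB : y ∉ B)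
    (f : MvPolynomial V K) : f * X y ∈ G.edgeVarIdeal K A B ↔ f ∈ G.edgeVarIdeal K A B := by
  classical
  simp only [mem_edgeVarIdeal_iff, support_mul_X, Finset.mem_map, addRightEmbedding_apply,
    forall_exists_index, and_imp, forall_apply_eq_imp_iff₂, Finsupp.add_apply,
    Finsupp.single_apply]
  refine forall₂_congr fun m _ => ?_
  grind

theorem mul_X_mem_edgeVarIdeal_iff [DecidableEq V] [DecidableRel G.Adj] {A B : Finset V} {y : V}
    (hA : y ∈ A) (hB : y ∉ B) (f : MvPolynomial V K) :
    f * X y ∈ G.edgeVarIdeal K A B ↔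
      f ∈ G.edgeVarIdeal K ((A.erase y).filter fun z => ¬ G.Adj y z) (B ∪ A.filter (G.Adj y)) := by
  simp only [mem_edgeVarIdeal_iff, support_mul_X, Finset.mem_map, addRightEmbedding_apply,
    forall_exists_index, and_imp, forall_apply_eq_imp_iff₂, Finsupp.add_apply,
    Finsupp.single_apply]
  refine forall₂_congr fun m _ => ?_
  have := fun u v => G.adj_comm u v
  have := fun u => G.irrefl (v := u)
  grind

theorem edgeVarIdeal_erase [DecidableEq V] {A B : Finset V} {x : V} (h : ∀ y ∈ A, ¬ G.Adj x y) :
    G.edgeVarIdeal K (A.erase x) B = G.edgeVarIdeal K A B := by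
  ext f
  simp only [mem_edgeVarIdeal_iff]
  refine forall₂_congr fun m _ => ?_
  have := fun u v => G.adj_comm u v
  grind

theorem hasProjectiveDimensionLE_edgeVarIdeal_empty (B : Finset V) :
    HasProjectiveDimensionLE (ModuleCat.of (MvPolynomial V K)
      (MvPolynomial V K ⧸ G.edgeVarIdeal K ∅ B)) B.card := by
  classical
  induction B using Finset.induction_on with
  | empty =>
    have : G.edgeVarIdeal K ∅ ∅ = ⊥ := by simp [edgeVarIdeal, edgeVarExponents]
    rw [Finset.card_empty, ← projective_iff_hasProjectiveDimensionLE_zero,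
      ← IsProjective.iff_projective]
    exact Module.Projective.of_equiv (Submodule.quotEquivOfEqBot _ this).symm
  | insert b B hb ih =>
    rw [Finset.card_insert_of_notMem hb]
    exact Ideal.hasProjectiveDimensionLE_quotient_sup_span_singleton
      (G.mul_X_mem_edgeVarIdeal_iff_of_notMem K (Finset.notMem_empty b) hb)
      (G.edgeVarIdeal_sup_span_X K (A := ∅) b) _ ih

/-- The neighbours of a vertex `x` are removed one at a time; `s` counts those already removed. -/
theorem hasProjectiveDimensionLE_edgeVarIdeal [DecidableRel G.Adj] {d : ℕ}
    (hd : ∀ (A : Finset V) (x : V), (A.filter (G.Adj x)).card ≤ d) (hd₀ : 1 ≤ d) (n : ℕ) :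
    ∀ (A B : Finset V) (s p : ℕ), A.card = n → Disjoint A B →
      (s = 0 ∨ ∃ x ∈ A, s + (A.filter (G.Adj x)).card ≤ d) →
      2 * d * (A.card + s) + 2 * d * B.card < 2 * d * (p + s + 1) + (A.card + s) →
      HasProjectiveDimensionLE (ModuleCat.of (MvPolynomial V K)
        (MvPolynomial V K ⧸ G.edgeVarIdeal K A B)) p := by
  classical
  induction n using Nat.strong_induction_on with
  | _ n ih =>
    rintro A B s p rfl hAB hs hp
    obtain rfl | hA := A.eq_empty_or_nonempty
    -- A positive `s` requires a vertex in `A`.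
    · obtain rfl : s = 0 := by simpa using hs
      have hBp : B.card < p + 1 := by
        simp only [Finset.card_empty, add_zero, mul_zero, zero_add] at hp
        exact lt_of_mul_lt_mul_left hp (Nat.zero_le _)
      have := G.hasProjectiveDimensionLE_edgeVarIdeal_empty K B
      exact hasProjectiveDimensionLT_of_ge _ (B.card + 1) _ (by omega)
    obtain ⟨x, hx, hxs⟩ : ∃ x ∈ A, s + (A.filter (G.Adj x)).card ≤ d := by
      obtain rfl | hs := hs
      · obtain ⟨x, hx⟩ := hA
        exact ⟨x, hx, by simpa using hd A x⟩
      · exact hs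
    obtain hN | ⟨y, hy⟩ := (A.filter (G.Adj x)).eq_empty_or_nonempty
    · have hc := Finset.card_erase_add_one hx
      -- `x` is now isolated in `A`. Dropping it lowers `|A| + |B|` by 1 and `|A| + s` by `s + 1 ≤ d
      -- + 1 ≤ 2d`.
      rw [← G.edgeVarIdeal_erase K (A := A) (x := x)
        (by simpa [Finset.filter_eq_empty_iff] using hN)]
      refine ih _ (by omega) (A.erase x) B 0 p rfl (hAB.mono_left (Finset.erase_subset _ _))
        (.inl rfl) ?_
      rw [← hc] at hp
      nlinarith
    · rw [Finset.mem_filter] at hy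
      obtain ⟨hyA, hxy⟩ := hy
      have hyB : y ∉ B := Finset.disjoint_left.1 hAB hyA
      have hc := Finset.card_erase_add_one hyA
      have hNx : ((A.erase y).filter (G.Adj x)).card + 1 = (A.filter (G.Adj x)).card := by
        rw [Finset.filter_erase, Finset.card_erase_add_one (by simp [hyA, hxy])]
      refine Ideal.hasProjectiveDimensionLE_quotient_of_colon
        (G.mul_X_mem_edgeVarIdeal_iff K hyA hyB) (G.edgeVarIdeal_sup_span_X K y) p ?_ ?_
      -- Colon branch: with `t ≤ d` neighbours of `y` in `A`, `|A| + |B|` drops by 1 and `|A| + s`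
      -- by `1 + t + s`. Since `y` is still a neighbour of `x`, `s + 1 ≤ d`, so the drop is at most
      -- `2d`.
      · have hy := hd A y
        have hcard : ((A.erase y).filter fun z => ¬ G.Adj y z).card +
            (A.filter (G.Adj y)).card + 1 = A.card := by
          have hN : (A.erase y).filter (G.Adj y) = A.filter (G.Adj y) := by
            rw [Finset.filter_erase, Finset.erase_eq_of_notMem (by simp)]
          have := Finset.card_filter_add_card_filter_not (s := A.erase y) (G.Adj y)
          rw [hN] at this
          omega
        have hcB : (B ∪ A.filter (G.Adj y)).card = B.card + (A.filter (G.Adj y)).card :=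
          Finset.card_union_of_disjoint (hAB.symm.mono_right (Finset.filter_subset _ _))
        refine ih _ (by omega) _ _ 0 p rfl ?_ (.inl rfl) ?_
        · rw [Finset.disjoint_left] at hAB ⊢
          intro z
          simp only [Finset.mem_filter, Finset.mem_erase, Finset.mem_union]
          grind
        · rw [hcB]
          rw [← hcard] at hp
          nlinarith
      -- Sum branch: `|A| + |B|` and `|A| + s` are both unchanged.
      · refine ih _ (by omega) (A.erase y) (insert y B) (s + 1) p rfl ?_ (.inr ⟨x, ?_, by omega⟩) ?_
        · rw [Finset.disjoint_left] at hAB ⊢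
          intro z
          simp only [Finset.mem_erase, Finset.mem_insert]
          grind
        · exact Finset.mem_erase.2 ⟨hxy.ne, hx⟩
        · rw [Finset.card_insert_of_notMem hyB]
          rw [← hc] at hp
          nlinarith

end SimpleGraph

theorem mainTheorem10 {K V : Type*} [Field K] [Fintype V] (G : SimpleGraph V)
    [DecidableRel G.Adj] (hG : G ≠ ⊥) :
    ∃ p : ℕ,
      CategoryTheory.projectiveDimension
        (ModuleCat.of (MvPolynomial V K) (MvPolynomial V K ⧸ G.edgeIdeal K)) = p ∧
      (p : ℝ) ≤ (Fintype.card V : ℝ) * (1 - 1 / (2 * (G.maxDegree : ℝ))) := by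
  classical
  have hd₀ : 1 ≤ G.maxDegree := by
    obtain ⟨x, y, hxy⟩ := G.ne_bot_iff_exists_adj.1 hG
    exact ((G.degree_pos_iff_exists_adj x).2 ⟨y, hxy⟩).trans_le (G.degree_le_maxDegree x)
  have hd (A : Finset V) (x : V) : (A.filter (G.Adj x)).card ≤ G.maxDegree := by
    refine le_trans (Finset.card_le_card fun z hz => ?_) (G.degree_le_maxDegree x)
    simpa using (Finset.mem_filter.1 hz).2
  generalize G.maxDegree = d at hd₀ hd
  set n := Fintype.card V
  -- The floor of the claimed bound; the subtraction does not truncate because `d ≥ 1`.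
  set q := n * (2 * d - 1) / (2 * d)
  obtain ⟨e, he⟩ : ∃ e, 2 * d = e + 1 := ⟨2 * d - 1, by omega⟩
  have hq : HasProjectiveDimensionLE (ModuleCat.of (MvPolynomial V K)
      (MvPolynomial V K ⧸ G.edgeIdeal K)) q := by
    rw [G.edgeIdeal_eq_edgeVarIdeal K]
    refine G.hasProjectiveDimensionLE_edgeVarIdeal K hd hd₀ _ Finset.univ ∅ 0 q rfl
      (Finset.disjoint_empty_right _) (.inl rfl) ?_
    have := Nat.lt_mul_div_succ (n * (2 * d - 1)) (b := 2 * d) (by omega)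
    change _ < 2 * d * (q + 1) at this
    simp only [Finset.card_univ, Finset.card_empty, add_zero, mul_zero]
    change 2 * d * n < _ + n
    rw [he] at this ⊢
    simp only [Nat.add_sub_cancel] at this
    nlinarith
  have hqn : (q : ℝ) ≤ n * (1 - 1 / (2 * (d : ℝ))) := by
    have h : q * (2 * d) ≤ n * (2 * d - 1) := Nat.div_mul_le_self _ _
    have hd' : (0 : ℝ) < 2 * d := by positivity
    have h' : (q : ℝ) * (2 * d) ≤ n * (2 * d - 1) := by
      rw [he, Nat.add_sub_cancel] at h
      have he' : (2 * d : ℝ) = e + 1 := by exact_mod_cast he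
      rw [he', add_sub_cancel_right]
      exact_mod_cast h
    rw [one_sub_div hd'.ne', ← mul_div_assoc, le_div_iff₀ hd']
    exact h'
  have hle := (projectiveDimension_le_iff _ q).2 hq
  -- The value `⊥` occurs only for the zero module, and the edge ideal is proper.
  have hbot : projectiveDimension (ModuleCat.of (MvPolynomial V K)
      (MvPolynomial V K ⧸ G.edgeIdeal K)) ≠ ⊥ := by
    rw [Ne, projectiveDimension_eq_bot_iff, ModuleCat.isZero_iff_subsingleton]
    change ¬ Subsingleton (MvPolynomial V K ⧸ G.edgeIdeal K)
    rw [Ideal.Quotient.subsingleton_iff, G.edgeIdeal_eq_edgeVarIdeal K]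
    exact G.edgeVarIdeal_ne_top K _ _
  generalize projectiveDimension (ModuleCat.of (MvPolynomial V K)
    (MvPolynomial V K ⧸ G.edgeIdeal K)) = r at hle hbot
  lift r to ℕ∞ using hbot
  have hle' : r ≤ (q : ℕ∞) := by exact_mod_cast hle
  lift r to ℕ using ne_top_of_le_ne_top (ENat.natCast_ne_top q) hle'
  refine ⟨r, rfl, le_trans ?_ hqn⟩
  exact_mod_cast hle'
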